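/- A finite rooted tree is called $d$-ary if every internal (non-leaf) vertex has at least two and at most $d$ children, and strictly $d$-ary if every internal vertex has exactly $d$ children; $\|T\|$ denotes the number of leaves of $T$. A nonempty set $S$ of leaves of a $d$-ary tree $T$ induces a tree as follows: take the smallest subtree of $T$ containing $S$, rooted at the most recent common ancestor of $S$, and suppress all vertices with exactly one child. For $d$-ary trees $D$ and $T$, let $c(D,T)$ be the number of sets of $\|D\|$ leaves of $T$ that induce a tree isomorphic to $D$ (as a rooted tree), let $\gamma(D,T)=c(D,T)/\binom{\|T\|}{\|D\|}$, and let $$I_d(D)=\limsup_{n\to\infty}\ \max_{\substack{\|T\|=n\\ T\ d\text{-ary tree}}}\gamma(D,T)$$ be the $d$-ary inducibility of $D$. **Corollary.** Let $d\ge 2$ and $h\ge 0$ be integers, and let $C_h^d$ be the complete $d$-ary tree of height $h$, that is, the strictly $d$-ary tree all of whose leaves are at distance $h$ from the root. Then $$I_d\big(C_h^d\big)=(d^h)!\,\prod_{i=0}^{h-1}\Big(d^{\,d^{h-i}}-d\Big)^{-d^i}.$$ -/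

import Mathlib

/-- Finite rooted trees: a root together with its `n` branches (the subtrees hanging from the
children of the root). A vertex without children (`n = 0`) is a leaf; in particular the
one-vertex tree consists of one leaf. The order of the branches carries no meaning:
trees are compared through `RTree.Iso`. -/
inductive RTree : Type
  | node (n : ℕ) (branch : Fin n → RTree) : RTree

namespace RTree

/-- Isomorphism of rooted trees (root-preserving): a bijection between the branches at the root
under which corresponding branches are isomorphic. -/
def Iso : RTree → RTree → Prop
  | node m f, node n g => ∃ e : Fin m ≃ Fin n, ∀ i, Iso (f i) (g (e i))

/-- The leaves of a rooted tree. -/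
def Leaves : RTree → Type
  | node 0 _ => Unit
  | node (n + 1) f => Σ i : Fin (n + 1), Leaves (f i)

noncomputable instance instFintypeLeaves : (T : RTree) → Fintype T.Leaves
  | node 0 _ => inferInstanceAs (Fintype Unit)
  | node (n + 1) f =>
    letI : ∀ i, Fintype (f i).Leaves := fun i => instFintypeLeaves (f i)
    inferInstanceAs (Fintype (Σ i : Fin (n + 1), (f i).Leaves))

/-- The size `‖T‖` of a tree: its number of leaves. -/
noncomputable def size (T : RTree) : ℕ := Fintype.card T.Leaves

/-- The distance of a leaf from the root. -/
def depth : (T : RTree) → T.Leaves → ℕ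
  | node 0 _, _ => 0
  | node (_ + 1) f, l => depth (f l.1) l.2 + 1

/-- `d`-ary trees: every internal vertex has at least two and at most `d` children. -/
def IsDary (d : ℕ) : RTree → Prop
  | node n f => (n = 0 ∨ (2 ≤ n ∧ n ≤ d)) ∧ ∀ i, IsDary d (f i)

/-- Strictly `d`-ary trees: every internal vertex has exactly `d` children. -/
def IsStrictlyDary (d : ℕ) : RTree → Prop
  | node n f => (n = 0 ∨ n = d) ∧ ∀ i, IsStrictlyDary d (f i)

/-- `C` is the complete `d`-ary tree of height `h`: it is strictly `d`-ary and all its leaves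
are at distance `h` from the root. -/
def IsComplete (d h : ℕ) (C : RTree) : Prop :=
  C.IsStrictlyDary d ∧ ∀ l : C.Leaves, C.depth l = h

open Classical in
/-- The subtree of `T` formed by all the vertices on the paths from the root to the leaves in a
nonempty set `S`: at every internal vertex, the branches without a leaf in `S` are deleted. -/
noncomputable def spanned : (T : RTree) → Set T.Leaves → RTree
  | node 0 f, _ => node 0 f
  | node (n + 1) f, S =>
    let J : Finset (Fin (n + 1)) := {i | ∃ l : (f i).Leaves, (⟨i, l⟩ : Σ i, (f i).Leaves) ∈ S}
    node J.card fun j =>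
      spanned (f (J.orderEmbOfFin rfl j)) {l | (⟨J.orderEmbOfFin rfl j, l⟩ : Σ i, (f i).Leaves) ∈ S}

/-- Suppress all the vertices with exactly one child. -/
def suppress : RTree → RTree
  | node n f =>
    if h : n = 1 then suppress (f ⟨0, by omega⟩) else node n fun i => suppress (f i)

/-- The subtree of `T` induced by a nonempty set `S` of leaves. In `spanned T S` the vertices above
the most recent common ancestor of `S` have a single child; `suppress` deletes them as well, so
the root of the result is that most recent common ancestor. -/
noncomputable def induced (T : RTree) (S : Set T.Leaves) : RTree := (T.spanned S).suppress

open Classical in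
/-- `c(D, T)`: the number of sets of `‖D‖` leaves of `T` that induce a tree isomorphic to `D`. -/
noncomputable def copies (D T : RTree) : ℕ :=
  (((Finset.univ : Finset T.Leaves).powersetCard D.size).filter
    fun S : Finset T.Leaves => Iso (T.induced (S : Set T.Leaves)) D).card

/-- The density `γ(D, T) = c(D, T) / (‖T‖ choose ‖D‖)`. -/
noncomputable def density (D T : RTree) : ℝ := (copies D T : ℝ) / (T.size.choose D.size : ℝ)

/-- The maximum density of `D` in a `d`-ary tree with `n` leaves. -/
noncomputable def maxDensity (d : ℕ) (D : RTree) (n : ℕ) : ℝ :=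
  sSup {x : ℝ | ∃ T : RTree, T.IsDary d ∧ T.size = n ∧ density D T = x}

/-- The `d`-ary inducibility of `D`. -/
noncomputable def inducibility (d : ℕ) (D : RTree) : ℝ :=
  Filter.limsup (fun n : ℕ => maxDensity d D n) Filter.atTop

/-- The complete `d`-ary tree of height `h` exists. -/
theorem exists_isComplete {d : ℕ} (hd : 0 < d) (h : ℕ) : ∃ C : RTree, C.IsComplete d h := by
  induction h with
  | zero => exact ⟨node 0 Fin.elim0, ⟨⟨Or.inl rfl, fun i => i.elim0⟩, fun _ => rfl⟩⟩
  | succ h ih =>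
    obtain ⟨C, h1, h2⟩ := ih
    obtain ⟨n, rfl⟩ : ∃ n, d = n + 1 := ⟨d - 1, by omega⟩
    refine ⟨node (n + 1) fun _ => C, ⟨⟨Or.inr rfl, fun _ => h1⟩, fun l => ?_⟩⟩
    change depth C l.2 + 1 = h + 1
    rw [h2]

/-- Densities lie between `0` and `1`. -/
theorem density_mem_Icc (D T : RTree) : density D T ∈ Set.Icc (0 : ℝ) 1 := by
  classical
  refine ⟨by unfold density; positivity, div_le_one_of_le₀ ?_ (by positivity)⟩
  have h := Finset.card_filter_le ((Finset.univ : Finset T.Leaves).powersetCard D.size)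
    (fun S : Finset T.Leaves => Iso (T.induced (S : Set T.Leaves)) D)
  rw [Finset.card_powersetCard, Finset.card_univ] at h
  unfold copies
  norm_cast

end RTree

/-! Write N_h(T) for the number of leaf sets of T inducing the complete tree of height h, and c_h
for `copiesCoeff d h`. A copy of height h+1 either lies inside one root branch or meets exactly d
branches, each in a copy of height h. As T has at most d root branches T_i, N_{h+1}(T) is the sum of
the N_{h+1}(T_i), plus the product of the N_h(T_i) when there are exactly d
(`ncard_inducing_succ_node`).

Upper bound: N_h(T) ≤ c_h ‖T‖^(d^h) by induction on h and T (`ncard_inducing_le`). With m = d^(h+1),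
the step is the inequality ∑ x_i^m + (d^m - d) ∏ x_i^(m/d) ≤ (∑ x_i)^m of `sum_pow_add_le_pow_sum`,
an equality when all x_i agree.

Lower bound: on complete trees of growing height the recursion for N_{h+1}(T)/‖T‖^m is affine with
ratio d/d^m < 1, and its limit is c_{h+1} = c_h^d/(d^m - d). A limsup only needs these sizes d^k.
The factor (d^h)! comes from replacing powers by binomial coefficients. -/

open Filter Topology

/-! ### Complete trees: recursive description, isomorphism, size. -/

namespace RTree

/-- The recursive form of `IsComplete`. -/
def Full (d : ℕ) : ℕ → RTree → Prop
  | 0, node m _ => m = 0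
  | h + 1, node m f => m = d ∧ ∀ i, Full d h (f i)

theorem nonempty_leaves (T : RTree) : Nonempty T.Leaves := by
  induction T with
  | node n f ih =>
    cases n with
    | zero => exact ⟨()⟩
    | succ n => obtain ⟨l⟩ := ih 0; exact ⟨⟨0, l⟩⟩

theorem IsComplete.full {d : ℕ} {h : ℕ} {C : RTree} (hC : C.IsComplete d h) :
    Full d h C := by
  induction h generalizing C with
  | zero =>
    cases C with
    | node n f =>
      cases n with
      | zero => rfl
      | succ n =>
        obtain ⟨l⟩ := nonempty_leaves (node (n + 1) f)
        exact absurd (hC.2 l) (Nat.succ_ne_zero _)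
  | succ h ih =>
    cases C with
    | node n f =>
      cases n with
      | zero => exact absurd (hC.2 ()) (Nat.succ_ne_zero _).symm
      | succ n =>
        obtain ⟨h1, h2⟩ := hC
        refine ⟨h1.1.resolve_left (Nat.succ_ne_zero n), fun i => ih ⟨h1.2 i, fun l => ?_⟩⟩
        exact Nat.succ.inj (h2 ⟨i, l⟩)

/-- Replaces the isomorphism test in `copies` by a predicate that recurses along the branches. -/
theorem Full.iso_iff {d h : ℕ} {C : RTree} (hC : Full d h C) (X : RTree) :
    Iso X C ↔ Full d h X := by
  induction h generalizing C X with
  | zero =>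
    cases C with
    | node n f =>
    cases X with
    | node m g =>
      have hn : n = 0 := hC
      subst hn
      constructor
      · rintro ⟨e, -⟩
        exact (by simpa using Fintype.card_congr e : m = 0)
      · intro (hm : m = 0)
        subst hm
        exact ⟨Equiv.refl _, fun i => i.elim0⟩
  | succ h ih =>
    cases C with
    | node n f =>
    cases X with
    | node m g =>
      obtain ⟨hn, hf⟩ := hC
      constructor
      · rintro ⟨e, he⟩
        have hmn : m = n := by simpa using Fintype.card_congr e
        exact ⟨hmn.trans hn, fun i => (ih (hf _) _).1 (he i)⟩
      · rintro ⟨hm, hg⟩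
        have hmn : m = n := hm.trans hn.symm
        subst hmn
        exact ⟨Equiv.refl _, fun i => (ih (hf _) _).2 (hg i)⟩

theorem size_leaf (f : Fin 0 → RTree) : (node 0 f).size = 1 := by
  exact (Fintype.card_congr (Equiv.refl Unit)).trans Fintype.card_unit

theorem size_node {n : ℕ} (f : Fin (n + 1) → RTree) :
    (node (n + 1) f).size = ∑ i, (f i).size := by
  have e : (node (n + 1) f).Leaves ≃ (Σ i : Fin (n + 1), (f i).Leaves) := Equiv.refl _
  unfold size
  rw [Fintype.card_congr e, Fintype.card_sigma]

theorem Full.size {d : ℕ} (hd : 0 < d) {h : ℕ} {C : RTree} (hC : Full d h C) :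
    C.size = d ^ h := by
  induction h generalizing C with
  | zero =>
    cases C with
    | node n f =>
      have hn : n = 0 := hC
      subst hn
      simpa using size_leaf f
  | succ h ih =>
    cases C with
    | node n f =>
      obtain ⟨rfl, hf⟩ := hC
      obtain ⟨k, rfl⟩ : ∃ k, n = k + 1 := ⟨n - 1, by omega⟩
      rw [size_node, Finset.sum_congr rfl fun i _ => ih (hf i)]
      simp [pow_succ, mul_comm]

theorem Full.isDary {d : ℕ} (hd : 2 ≤ d) {h : ℕ} {C : RTree} (hC : Full d h C) :
    C.IsDary d := by
  induction h generalizing C with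
  | zero =>
    cases C with
    | node n f =>
      have hn : n = 0 := hC
      subst hn
      exact ⟨Or.inl rfl, fun i => i.elim0⟩
  | succ h ih =>
    cases C with
    | node n f =>
      obtain ⟨rfl, hf⟩ := hC
      exact ⟨Or.inr ⟨hd, le_rfl⟩, fun i => ih (hf i)⟩

/-! ### Induced trees, branch by branch. -/

/-- The part of a set of leaves that lies in the `i`-th branch. -/
def branchSet {n : ℕ} {f : Fin (n + 1) → RTree} (S : Set (node (n + 1) f).Leaves)
    (i : Fin (n + 1)) : Set (f i).Leaves :=
  {l | (⟨i, l⟩ : Σ i, (f i).Leaves) ∈ S}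

open Classical in
/-- The branches that contain a leaf of the set. -/
noncomputable def support {n : ℕ} {f : Fin (n + 1) → RTree} (S : Set (node (n + 1) f).Leaves) :
    Finset (Fin (n + 1)) :=
  {i | ∃ l : (f i).Leaves, (⟨i, l⟩ : Σ i, (f i).Leaves) ∈ S}

theorem mem_support {n : ℕ} {f : Fin (n + 1) → RTree} {S : Set (node (n + 1) f).Leaves}
    {i : Fin (n + 1)} : i ∈ support S ↔ (branchSet S i).Nonempty := by
  classical
  exact Finset.mem_filter.trans (and_iff_right (Finset.mem_univ i))

theorem spanned_node {n : ℕ} {f : Fin (n + 1) → RTree} (S : Set (node (n + 1) f).Leaves) :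
    (node (n + 1) f).spanned S = node (support S).card fun j =>
      (f ((support S).orderEmbOfFin rfl j)).spanned
        (branchSet S ((support S).orderEmbOfFin rfl j)) := by
  rw [spanned]
  rfl

theorem induced_of_support_eq_singleton {n : ℕ} {f : Fin (n + 1) → RTree}
    {S : Set (node (n + 1) f).Leaves} {i : Fin (n + 1)} (h : support S = {i}) :
    (node (n + 1) f).induced S = (f i).induced (branchSet S i) := by
  have h1 : (support S).card = 1 := by simp [h]
  rw [induced, spanned_node, suppress, dif_pos h1]
  -- The only index in the support equals i propositionally but not definitionally, and the type of
  -- `branchSet S j` depends on j; hence the generalization.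
  have key : ∀ j, j = i → ((f j).spanned (branchSet S j)).suppress =
      (f i).induced (branchSet S i) := by
    rintro j rfl
    rfl
  apply key
  have := (support S).orderEmbOfFin_mem rfl ⟨0, by omega⟩
  exact Finset.mem_singleton.1 (h.subset this)

/-- Cardinality 0 is allowed: the empty set induces a one-vertex tree, which is why `Inducing`
demands nonempty sets. -/
theorem induced_of_card_support_ne_one {n : ℕ} {f : Fin (n + 1) → RTree}
    {S : Set (node (n + 1) f).Leaves} (h : (support S).card ≠ 1) :
    (node (n + 1) f).induced S = node (support S).card fun j =>
      (f ((support S).orderEmbOfFin rfl j)).induced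
        (branchSet S ((support S).orderEmbOfFin rfl j)) := by
  rw [induced, spanned_node, suppress, dif_neg h]
  rfl

theorem induced_leaf (f : Fin 0 → RTree) (S : Set (node 0 f).Leaves) :
    ∃ g, (node 0 f).induced S = node 0 g := by
  rw [induced, spanned, suppress, dif_neg (by omega)]
  exact ⟨_, rfl⟩

/-- The nonempty sets of leaves of `T` that induce a complete `d`-ary tree of height `h`. -/
def Inducing (d h : ℕ) (T : RTree) : Set (Set T.Leaves) :=
  {S | S.Nonempty ∧ Full d h (T.induced S)}

theorem support_nonempty {n : ℕ} {f : Fin (n + 1) → RTree} {S : Set (node (n + 1) f).Leaves}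
    (hS : S.Nonempty) : (support S).Nonempty := by
  obtain ⟨⟨i, l⟩, hl⟩ := hS
  exact ⟨i, mem_support.2 ⟨l, hl⟩⟩

theorem nonempty_of_mem_support {n : ℕ} {f : Fin (n + 1) → RTree}
    {S : Set (node (n + 1) f).Leaves} {i : Fin (n + 1)} (hi : i ∈ support S) : S.Nonempty := by
  obtain ⟨l, hl⟩ := mem_support.1 hi
  exact ⟨⟨i, l⟩, hl⟩

theorem full_induced_of_card_support_ne_one {d h n : ℕ} {f : Fin (n + 1) → RTree}
    {S : Set (node (n + 1) f).Leaves} (hS : (support S).card ≠ 1) :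
    Full d (h + 1) ((node (n + 1) f).induced S) ↔
      (support S).card = d ∧ ∀ i ∈ support S, Full d h ((f i).induced (branchSet S i)) := by
  rw [induced_of_card_support_ne_one hS]
  refine and_congr_right fun _ => ⟨fun H i hi => ?_, fun H j => H _ (Finset.orderEmbOfFin_mem _ _ _)⟩
  have : i ∈ Set.range ((support S).orderEmbOfFin rfl) := by simpa using hi
  obtain ⟨j, rfl⟩ := this
  exact H j

theorem mem_inducing_zero_node {d n : ℕ} {f : Fin (n + 1) → RTree}
    {S : Set (node (n + 1) f).Leaves} :
    S ∈ Inducing d 0 (node (n + 1) f) ↔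
      ∃ i, support S = {i} ∧ branchSet S i ∈ Inducing d 0 (f i) := by
  constructor
  · rintro ⟨h1, h2⟩
    have hJ := support_nonempty h1
    by_cases h : (support S).card = 1
    · obtain ⟨i, hi⟩ := Finset.card_eq_one.1 h
      rw [induced_of_support_eq_singleton hi] at h2
      exact ⟨i, hi, mem_support.1 (by simp [hi]), h2⟩
    · rw [induced_of_card_support_ne_one h] at h2
      exact absurd h2 hJ.card_ne_zero
  · rintro ⟨i, hi, h1, h2⟩
    refine ⟨nonempty_of_mem_support (mem_support.2 h1), ?_⟩
    rwa [induced_of_support_eq_singleton hi]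

/-- The alternatives say whether the root of T is suppressed or is itself the root of the copy. -/
theorem mem_inducing_succ_node {d h n : ℕ} (hd : 2 ≤ d) {f : Fin (n + 1) → RTree}
    {S : Set (node (n + 1) f).Leaves} :
    S ∈ Inducing d (h + 1) (node (n + 1) f) ↔
      (∃ i, support S = {i} ∧ branchSet S i ∈ Inducing d (h + 1) (f i)) ∨
      ((support S).card = d ∧ ∀ i ∈ support S, branchSet S i ∈ Inducing d h (f i)) := by
  constructor
  · rintro ⟨h1, h2⟩
    by_cases hc : (support S).card = 1
    · obtain ⟨i, hi⟩ := Finset.card_eq_one.1 hc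
      rw [induced_of_support_eq_singleton hi] at h2
      exact Or.inl ⟨i, hi, mem_support.1 (by simp [hi]), h2⟩
    · rw [full_induced_of_card_support_ne_one hc] at h2
      exact Or.inr ⟨h2.1, fun i hi => ⟨mem_support.1 hi, h2.2 i hi⟩⟩
  · rintro (⟨i, hi, h1, h2⟩ | ⟨h1, h2⟩)
    · refine ⟨nonempty_of_mem_support (mem_support.2 h1), ?_⟩
      rwa [induced_of_support_eq_singleton hi]
    · obtain ⟨i, hi⟩ : (support S).Nonempty := Finset.card_pos.1 (by omega)
      exact ⟨nonempty_of_mem_support hi, (full_induced_of_card_support_ne_one (by omega)).2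
        ⟨h1, fun i hi => (h2 i hi).2⟩⟩

theorem ncard_eq_sum_branchSet {n : ℕ} {f : Fin (n + 1) → RTree}
    (S : Set (node (n + 1) f).Leaves) :
    S.ncard = ∑ i ∈ support S, (branchSet S i).ncard := by
  have e : S ≃ Σ i, branchSet S i :=
    { toFun := fun x => ⟨x.1.1, ⟨x.1.2, x.2⟩⟩
      invFun := fun x => ⟨⟨x.1, x.2.1⟩, x.2.2⟩
      left_inv := fun _ => rfl
      right_inv := fun _ => rfl }
  rw [← Nat.card_coe_set_eq, Nat.card_congr e, Nat.card_sigma]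
  symm
  apply Finset.sum_subset (Finset.subset_univ _)
  intro i _ hi
  rw [mem_support, Set.not_nonempty_iff_eq_empty] at hi
  simp [hi]

/-- The cardinality condition in `copies` is thus automatic, so `Inducing` can omit it. -/
theorem ncard_of_mem_inducing {d : ℕ} (hd : 2 ≤ d) {T : RTree} :
    ∀ {h : ℕ} {S : Set T.Leaves}, S ∈ Inducing d h T → S.ncard = d ^ h := by
  induction T with
  | node n f ih =>
    intro h S hS
    cases n with
    | zero =>
      obtain ⟨h1, h2⟩ := hS
      obtain ⟨g, hg⟩ := induced_leaf f S
      rw [hg] at h2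
      cases h with
      | zero =>
        rw [pow_zero, Set.ncard_eq_one]
        obtain ⟨l, hl⟩ := h1
        exact ⟨l, Set.eq_singleton_iff_unique_mem.2 ⟨hl, fun _ _ => rfl⟩⟩
      | succ h =>
        have : 0 = d := h2.1
        omega
    | succ n =>
      rw [ncard_eq_sum_branchSet]
      cases h with
      | zero =>
        obtain ⟨i, hi, h1⟩ := mem_inducing_zero_node.1 hS
        rw [hi, Finset.sum_singleton, ih i h1]
      | succ h =>
        obtain ⟨i, hi, h1⟩ | ⟨h1, h2⟩ := (mem_inducing_succ_node hd).1 hS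
        · rw [hi, Finset.sum_singleton, ih i h1]
        · rw [Finset.sum_congr rfl fun i hi => ih i (h2 i hi), Finset.sum_const, h1, pow_succ,
            smul_eq_mul, mul_comm]

theorem mem_inducing_zero_of_ncard_eq_one {d : ℕ} {T : RTree} :
    ∀ {S : Set T.Leaves}, S.ncard = 1 → S ∈ Inducing d 0 T := by
  induction T with
  | node n f ih =>
    intro S hS
    have hne : S.Nonempty := Set.nonempty_of_ncard_ne_zero (by omega)
    cases n with
    | zero =>
      obtain ⟨g, hg⟩ := induced_leaf f S
      refine ⟨hne, ?_⟩
      rw [hg]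
      rfl
    | succ n =>
      obtain ⟨⟨i, l⟩, rfl⟩ := Set.ncard_eq_one.1 hS
      have hi : support (f := f) {⟨i, l⟩} = {i} := by
        ext j
        rw [mem_support, Finset.mem_singleton]
        constructor
        · rintro ⟨l', hl'⟩
          exact congrArg Sigma.fst (Set.mem_singleton_iff.1 hl')
        · rintro rfl
          exact ⟨l, rfl⟩
      refine mem_inducing_zero_node.2 ⟨i, hi, ih i ?_⟩
      rw [ncard_eq_sum_branchSet, hi, Finset.sum_singleton] at hS
      exact hS

theorem Full.copies_eq {d : ℕ} (hd : 2 ≤ d) {h : ℕ} {C : RTree} (hC : Full d h C) (T : RTree) :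
    copies C T = (Inducing d h T).ncard := by
  classical
  unfold copies
  rw [← Set.ncard_coe_finset]
  refine Set.ncard_congr (fun S _ => (S : Set T.Leaves)) ?_ ?_ ?_
  · intro S hS
    simp only [Finset.coe_filter, Finset.mem_powersetCard, Set.mem_ofPred_eq] at hS
    refine ⟨?_, (hC.iso_iff _).1 hS.2⟩
    rw [Finset.coe_nonempty, ← Finset.card_pos, hS.1.2, hC.size (by omega)]
    positivity
  · intro S S' _ _ hSS
    exact Finset.coe_injective hSS
  · intro S hS
    refine ⟨(Set.toFinite S).toFinset, ?_, by simp⟩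
    simp only [Finset.coe_filter, Finset.mem_powersetCard, Set.mem_ofPred_eq,
      Finset.subset_univ, true_and, Set.Finite.coe_toFinset]
    refine ⟨?_, (hC.iso_iff _).2 hS.2⟩
    rw [← Set.ncard_eq_toFinset_card, hC.size (by omega), ncard_of_mem_inducing hd hS]

theorem ncard_inducing_zero {d : ℕ} (hd : 2 ≤ d) (T : RTree) :
    (Inducing d 0 T).ncard = T.size := by
  have : Inducing d 0 T = Set.range fun l : T.Leaves => ({l} : Set T.Leaves) := by
    ext S
    constructor
    · intro hS
      obtain ⟨l, rfl⟩ := Set.ncard_eq_one.1 ((ncard_of_mem_inducing hd hS).trans (pow_zero d))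
      exact ⟨l, rfl⟩
    · rintro ⟨l, rfl⟩
      exact mem_inducing_zero_of_ncard_eq_one (Set.ncard_singleton l)
  rw [this, ← Set.image_univ, Set.ncard_image_of_injective _ Set.singleton_injective,
    Set.ncard_univ, Nat.card_eq_fintype_card, size]

theorem inducing_succ_leaf {d : ℕ} (hd : 2 ≤ d) (h : ℕ) (f : Fin 0 → RTree) :
    Inducing d (h + 1) (node 0 f) = ∅ := by
  rw [Set.eq_empty_iff_forall_notMem]
  rintro S ⟨-, h2⟩
  obtain ⟨g, hg⟩ := induced_leaf f S
  rw [hg] at h2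
  have : 0 = d := h2.1
  omega

/-! ### Counting copies: the recursion over the branches. -/

/-- The set of leaves with prescribed parts in the branches. -/
def unionBranches {n : ℕ} {f : Fin (n + 1) → RTree} (s : ∀ i, Set (f i).Leaves) :
    Set (node (n + 1) f).Leaves :=
  fun l => l.2 ∈ s l.1

theorem branchSet_unionBranches {n : ℕ} {f : Fin (n + 1) → RTree} (s : ∀ i, Set (f i).Leaves) :
    branchSet (unionBranches s) = s := rfl

theorem unionBranches_branchSet {n : ℕ} {f : Fin (n + 1) → RTree}
    (S : Set (node (n + 1) f).Leaves) : unionBranches (branchSet S) = S := rfl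

theorem support_unionBranches_update {n : ℕ} {f : Fin (n + 1) → RTree} {i : Fin (n + 1)}
    {t : Set (f i).Leaves} (ht : t.Nonempty) :
    support (unionBranches (Function.update (fun j => (∅ : Set (f j).Leaves)) i t)) = {i} := by
  ext j
  rw [mem_support, branchSet_unionBranches, Finset.mem_singleton]
  by_cases h : j = i
  · subst h
    simpa using ht
  · simp [h]

theorem eq_unionBranches_of_support_eq {n : ℕ} {f : Fin (n + 1) → RTree}
    {S : Set (node (n + 1) f).Leaves} {i : Fin (n + 1)} (h : support S = {i}) :
    unionBranches (Function.update (fun j => (∅ : Set (f j).Leaves)) i (branchSet S i)) = S := by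
  rw [← unionBranches_branchSet S]
  congr 1
  funext j
  by_cases hj : j = i
  · subst hj
    simp [branchSet_unionBranches]
  · have : j ∉ support S := by simpa [h] using hj
    rw [mem_support, Set.not_nonempty_iff_eq_empty] at this
    rw [Function.update_of_ne hj, this]

theorem ncard_support_singleton {d h n : ℕ} (f : Fin (n + 1) → RTree) :
    {S : Set (node (n + 1) f).Leaves |
      ∃ i, support S = {i} ∧ branchSet S i ∈ Inducing d h (f i)}.ncard =
      ∑ i, (Inducing d h (f i)).ncard := by
  have e : Nat.card (Σ i, Inducing d h (f i)) = Nat.card {S : Set (node (n + 1) f).Leaves |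
      ∃ i, support S = {i} ∧ branchSet S i ∈ Inducing d h (f i)} := by
    refine Nat.card_congr (Equiv.ofBijective (fun x => ⟨unionBranches
      (Function.update (fun j => (∅ : Set (f j).Leaves)) x.1 x.2.1), x.1,
        support_unionBranches_update x.2.2.1, ?_⟩) ⟨?_, ?_⟩)
    · rw [branchSet_unionBranches, Function.update_self]
      exact x.2.2
    · rintro ⟨i, t, ht⟩ ⟨j, u, hu⟩ hij
      have h1 := Subtype.ext_iff.1 hij
      dsimp only at h1
      have h2 := congrArg support h1
      rw [support_unionBranches_update ht.1, support_unionBranches_update hu.1,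
        Finset.singleton_inj] at h2
      subst h2
      have h3 := congrFun (congrArg branchSet h1) i
      rw [branchSet_unionBranches, branchSet_unionBranches, Function.update_self,
        Function.update_self] at h3
      subst h3
      rfl
    · rintro ⟨S, i, hi, hS⟩
      exact ⟨⟨i, branchSet S i, hS⟩, Subtype.ext (eq_unionBranches_of_support_eq hi)⟩
  rw [← Nat.card_coe_set_eq, ← e, Nat.card_sigma]
  rfl

theorem ncard_support_univ {d h n : ℕ} (f : Fin (n + 1) → RTree) :
    {S : Set (node (n + 1) f).Leaves | ∀ i, branchSet S i ∈ Inducing d h (f i)}.ncard =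
      ∏ i, (Inducing d h (f i)).ncard := by
  have e : {S : Set (node (n + 1) f).Leaves | ∀ i, branchSet S i ∈ Inducing d h (f i)} ≃
      ∀ i, Inducing d h (f i) :=
    { toFun := fun S i => ⟨branchSet S.1 i, S.2 i⟩
      invFun := fun s => ⟨unionBranches fun i => (s i).1, fun i => (s i).2⟩
      left_inv := fun _ => rfl
      right_inv := fun _ => rfl }
  rw [← Nat.card_coe_set_eq, Nat.card_congr e, Nat.card_pi]
  rfl

/-- The recursion for the number of copies of a complete tree. -/
theorem ncard_inducing_succ_node {d n : ℕ} (h : ℕ) (hd : 2 ≤ d) (hn : n + 1 ≤ d)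
    (f : Fin (n + 1) → RTree) :
    (Inducing d (h + 1) (node (n + 1) f)).ncard = ∑ i, (Inducing d (h + 1) (f i)).ncard +
      if n + 1 = d then ∏ i, (Inducing d h (f i)).ncard else 0 := by
  rw [← ncard_support_singleton, ← ncard_support_univ]
  split_ifs with hnd
  · rw [← Set.ncard_union_eq]
    · congr 1
      ext S
      rw [mem_inducing_succ_node hd]
      refine or_congr Iff.rfl ⟨fun ⟨h1, h2⟩ i => h2 i ?_, fun H => ?_⟩
      -- With exactly d branches, a support of size d contains all of them.
      · rw [(Finset.card_eq_iff_eq_univ (support S)).1 (by simpa using h1.trans hnd.symm)]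
        exact Finset.mem_univ i
      · have : support S = Finset.univ :=
          Finset.eq_univ_of_forall fun i => mem_support.2 (H i).1
        exact ⟨by simpa [this] using hnd, fun i _ => H i⟩
    · rw [Set.disjoint_left]
      rintro S ⟨i, hi, -⟩ H
      have : support S = Finset.univ :=
        Finset.eq_univ_of_forall fun i => mem_support.2 (H i).1
      have hc := congrArg Finset.card (hi.symm.trans this)
      simp at hc
      omega
  · rw [add_zero]
    congr 1
    ext S
    rw [mem_inducing_succ_node hd]
    refine or_iff_left fun ⟨h1, _⟩ => hnd ?_
    have := Finset.card_le_univ (support S)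
    simp at this
    omega

end RTree

/-! ### Inequalities and limits of real sequences. -/

/-- The inequality between arithmetic and geometric means without roots. -/
theorem card_mul_le_sum_of_prod_eq_pow {d : ℕ} (hd : 0 < d) {t : Fin d → ℝ} (ht : ∀ i, 0 ≤ t i)
    {y : ℝ} (hy : 0 ≤ y) (h : ∏ i, t i = y ^ d) : d * y ≤ ∑ i, t i := by
  have hd' : (0 : ℝ) < d := by exact_mod_cast hd
  have key := Real.geom_mean_le_arith_mean Finset.univ (fun _ => (1 : ℝ)) t (by simp)
    (by simpa using hd) (fun i _ => ht i)
  simp only [Real.rpow_one, h, Finset.sum_const, Finset.card_univ, Fintype.card_fin, nsmul_eq_mul,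
    mul_one, one_mul] at key
  rw [Real.pow_rpow_inv_natCast hy hd.ne', le_div_iff₀ hd'] at key
  linarith

/-- By the AM-GM inequality over the cyclic shifts of the words in the expansion of the left-hand
side, the mixed terms of a power of a sum dominate multiples of the balanced term. -/
theorem sum_pow_add_le_pow_sum {d b : ℕ} (hd : 0 < d) (hb : 0 < b) (x : Fin d → ℝ)
    (hx : ∀ i, 0 ≤ x i) :
    ∑ i, x i ^ (d * b) + ((d : ℝ) ^ (d * b) - d) * ∏ i, x i ^ b ≤ (∑ i, x i) ^ (d * b) := by
  classical
  have : NeZero d := ⟨hd.ne'⟩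
  have : NeZero (d * b) := ⟨(Nat.mul_pos hd hb).ne'⟩
  set m := d * b
  set y := ∏ i, x i ^ b with hy_def
  have hy : 0 ≤ y := Finset.prod_nonneg fun i _ => pow_nonneg (hx i) b
  let F : (Fin m → Fin d) → ℝ := fun p => ∏ j, x (p j)
  -- The words of length m index the expansion of the m-th power; the constant words `A` give the
  -- pure powers, and the other d^m - d words are mixed.
  let A : Finset (Fin m → Fin d) := Finset.univ.image (Function.const (Fin m))
  have hinj : Function.Injective (Function.const (Fin m) : Fin d → Fin m → Fin d) :=
    Function.const_injective
  have hA : ∑ p ∈ A, F p = ∑ i, x i ^ m := by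
    rw [Finset.sum_image hinj.injOn]
    simp [F]
  have hAcard : A.card = d := by
    rw [Finset.card_image_of_injective _ hinj]
    simp
  have hAc : (Aᶜ.card : ℝ) = (d : ℝ) ^ m - d := by
    have := Finset.card_add_card_compl A
    rw [hAcard] at this
    simp only [Fintype.card_fun, Fintype.card_fin] at this
    have h2 : (d : ℝ) + Aᶜ.card = (d : ℝ) ^ m := by exact_mod_cast this
    linarith
  have hmem : ∀ (s : Fin d) (p : Fin m → Fin d), p ∈ A ↔ (fun j => p j + s) ∈ A := by
    intro s p
    simp only [A, Finset.mem_image, Finset.mem_univ, true_and]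
    constructor
    · rintro ⟨i, rfl⟩
      exact ⟨i + s, rfl⟩
    · rintro ⟨i, hi⟩
      refine ⟨i - s, funext fun j => ?_⟩
      have := congrFun hi j
      simp only [Function.const_apply] at this
      simp [this]
  have hshift : ∀ s : Fin d, ∑ p ∈ Aᶜ, F (fun j => p j + s) = ∑ p ∈ Aᶜ, F p := by
    intro s
    refine Finset.sum_equiv (Equiv.addRight (fun _ => s : Fin m → Fin d)) ?_ fun _ _ => rfl
    intro p
    rw [Finset.mem_compl, Finset.mem_compl, hmem s p]
    rfl
  -- As s varies, the letter at each position runs once through all d values, so the d shifted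
  -- monomials have product (∏ x_i)^m = y^d.
  have hword : ∀ p : Fin m → Fin d, d * y ≤ ∑ s : Fin d, F (fun j => p j + s) := by
    intro p
    refine card_mul_le_sum_of_prod_eq_pow hd (fun s => Finset.prod_nonneg fun j _ => hx _) hy ?_
    rw [Finset.prod_comm]
    have : ∀ j : Fin m, ∏ s : Fin d, x (p j + s) = ∏ i, x i := fun j =>
      Equiv.prod_comp (Equiv.addLeft (p j)) x
    simp only [this, Finset.prod_const, Finset.card_univ, Fintype.card_fin]
    rw [hy_def, Finset.prod_pow, ← pow_mul, mul_comm b d]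
  -- Each shift permutes the mixed words, so summing over all shifts counts their total d times.
  have hmix : d * (Aᶜ.card * y) ≤ d * ∑ p ∈ Aᶜ, F p := by
    calc (d : ℝ) * (Aᶜ.card * y) = ∑ p ∈ Aᶜ, d * y := by
          rw [Finset.sum_const, nsmul_eq_mul]; ring
      _ ≤ ∑ p ∈ Aᶜ, ∑ s : Fin d, F (fun j => p j + s) := Finset.sum_le_sum fun p _ => hword p
      _ = ∑ s : Fin d, ∑ p ∈ Aᶜ, F p := by
          rw [Finset.sum_comm]
          exact Finset.sum_congr rfl fun s _ => hshift s
      _ = d * ∑ p ∈ Aᶜ, F p := by simp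
  have hmix' := le_of_mul_le_mul_left hmix (by exact_mod_cast hd)
  have htotal : (∑ i, x i) ^ m = ∑ p ∈ A, F p + ∑ p ∈ Aᶜ, F p := by
    rw [Finset.sum_add_sum_compl, Fintype.sum_pow]
  rw [htotal, hA, ← hAc]
  linarith

theorem sum_pow_le_pow_sum {ι : Type*} (s : Finset ι) (x : ι → ℝ) (hx : ∀ i ∈ s, 0 ≤ x i) {m : ℕ}
    (hm : m ≠ 0) : ∑ i ∈ s, x i ^ m ≤ (∑ i ∈ s, x i) ^ m := by
  classical
  induction s using Finset.induction_on with
  | empty => simp [hm]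
  | insert a s ha ih =>
    rw [Finset.sum_insert ha, Finset.sum_insert ha]
    have h1 := ih fun i hi => hx i (Finset.mem_insert_of_mem hi)
    have h2 := pow_add_pow_le (hx a (Finset.mem_insert_self a s))
      (Finset.sum_nonneg fun i hi => hx i (Finset.mem_insert_of_mem hi)) hm
    linarith

theorem tendsto_zero_of_le_mul_add {e δ : ℕ → ℝ} {ρ : ℝ} (hρ : 0 ≤ ρ) (hρ1 : ρ < 1)
    (he : ∀ k, 0 ≤ e k) (hδ : Tendsto δ atTop (𝓝 0)) (h : ∀ k, e (k + 1) ≤ ρ * e k + δ k) :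
    Tendsto e atTop (𝓝 0) := by
  rw [Metric.tendsto_atTop]
  intro ε hε
  obtain ⟨K, hK⟩ := (hδ.eventually_lt_const
    (show 0 < (1 - ρ) * (ε / 2) by have := sub_pos.2 hρ1; positivity)).exists_forall_of_atTop
  -- The threshold (1 - ρ)ε/2 is chosen so that ρ·ε/2 + (1 - ρ)ε/2 = ε/2 preserves the bound.
  have hj : ∀ j, e (K + j) ≤ ρ ^ j * e K + ε / 2 := by
    intro j
    induction j with
    | zero => simp; linarith
    | succ j ih =>
      have h1 := h (K + j)
      have h2 := hK (K + j) (by omega)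
      have h3 := mul_le_mul_of_nonneg_left ih hρ
      rw [← add_assoc, pow_succ]
      linarith
  have hlim : Tendsto (fun j => ρ ^ j * e K + ε / 2) atTop (𝓝 (0 * e K + ε / 2)) :=
    ((tendsto_pow_atTop_nhds_zero_of_lt_one hρ hρ1).mul_const _).add_const _
  obtain ⟨J, hJ⟩ := (hlim.eventually_lt_const (show _ < ε by linarith)).exists_forall_of_atTop
  refine ⟨K + J, fun n hn => ?_⟩
  obtain ⟨j, rfl⟩ : ∃ j, n = K + j := ⟨n - K, by omega⟩
  rw [Real.dist_eq, sub_zero, abs_of_nonneg (he _)]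
  exact (hj j).trans_lt (hJ j (by omega))

/-- The limit of an affine recursion. -/
theorem tendsto_of_affine_recursion {r s : ℕ → ℝ} {ρ σ : ℝ} (hρ : 0 ≤ ρ) (hρ1 : ρ < 1)
    (hs : Tendsto s atTop (𝓝 σ)) (h : ∀ k, r (k + 1) = ρ * r k + s k) :
    Tendsto r atTop (𝓝 (σ / (1 - ρ))) := by
  have hne : 1 - ρ ≠ 0 := (sub_pos.2 hρ1).ne'
  rw [tendsto_iff_dist_tendsto_zero]
  refine tendsto_zero_of_le_mul_add hρ hρ1 (fun _ => dist_nonneg)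
    (tendsto_iff_dist_tendsto_zero.1 hs) fun k => ?_
  have : r (k + 1) - σ / (1 - ρ) = ρ * (r k - σ / (1 - ρ)) + (s k - σ) := by
    rw [h]
    field_simp
    ring
  simp only [Real.dist_eq]
  rw [this]
  refine (abs_add_le _ _).trans_eq ?_
  rw [abs_mul, abs_of_nonneg hρ]

theorem tendsto_pow_div_choose (m : ℕ) :
    Tendsto (fun n : ℕ => (n : ℝ) ^ m / (n.choose m : ℝ)) atTop (𝓝 (m.factorial : ℝ)) := by
  have h := (Asymptotics.isEquivalent_iff_tendsto_one (by
    filter_upwards [eventually_gt_atTop 0] with n hn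
    positivity)).1 (isEquivalent_choose m)
  have h2 := (h.inv₀ one_ne_zero).const_mul (m.factorial : ℝ)
  rw [inv_one, mul_one] at h2
  refine h2.congr fun n => ?_
  have : (m.factorial : ℝ) ≠ 0 := by positivity
  simp only [Pi.div_apply, inv_div]
  field_simp

/-! ### The upper bound for all d-ary trees. -/

namespace RTree

/-- The asymptotic number of copies of the complete `d`-ary tree of height `h` in a tree with `n`
leaves, divided by `n ^ d ^ h`. -/
noncomputable def copiesCoeff (d : ℕ) : ℕ → ℝ
  | 0 => 1
  | h + 1 => copiesCoeff d h ^ d / ((d : ℝ) ^ d ^ (h + 1) - d)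

theorem pow_sub_self_pos {d : ℕ} (hd : 2 ≤ d) (h : ℕ) : 0 < (d : ℝ) ^ d ^ (h + 1) - d := by
  have h1 : 1 < d ^ (h + 1) := Nat.one_lt_pow (by omega) (by omega)
  have h2 : (d : ℝ) ^ 1 < (d : ℝ) ^ d ^ (h + 1) :=
    pow_lt_pow_right₀ (by exact_mod_cast hd) h1
  rw [pow_one] at h2
  linarith

theorem copiesCoeff_nonneg {d : ℕ} (hd : 2 ≤ d) (h : ℕ) : 0 ≤ copiesCoeff d h := by
  induction h with
  | zero => exact zero_le_one
  | succ h ih => exact div_nonneg (pow_nonneg ih d) (pow_sub_self_pos hd h).le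

theorem copiesCoeff_eq_prod (d h : ℕ) :
    copiesCoeff d h =
      ∏ i ∈ Finset.range h, ((d : ℝ) ^ (d ^ (h - i)) - (d : ℝ)) ^ (-((d : ℤ) ^ i)) := by
  induction h with
  | zero => rfl
  | succ h ih =>
    -- The new denominator is the factor i = 0; the d-th power turns the old factor i into the
    -- factor i + 1.
    rw [Finset.prod_range_succ', copiesCoeff, ih, ← Finset.prod_pow, div_eq_mul_inv]
    congr 1
    · refine Finset.prod_congr rfl fun i _ => ?_
      rw [Nat.add_sub_add_right, ← zpow_natCast, ← zpow_mul]
      congr 1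
      rw [pow_succ]
      ring
    · simp

theorem ncard_inducing_le {d : ℕ} (hd : 2 ≤ d) (h : ℕ) {T : RTree} (hT : T.IsDary d) :
    ((Inducing d h T).ncard : ℝ) ≤ copiesCoeff d h * (T.size : ℝ) ^ d ^ h := by
  induction h generalizing T with
  | zero => simp [ncard_inducing_zero hd, copiesCoeff]
  | succ h ihh =>
    have hpos := pow_sub_self_pos hd h
    have hc := copiesCoeff_nonneg hd (h + 1)
    induction T with
    | node n f ih =>
      obtain _ | n := n
      · rw [inducing_succ_leaf hd, Set.ncard_empty, Nat.cast_zero]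
        positivity
      · have hn : n + 1 ≤ d := by
          rcases hT.1 with h0 | h0 <;> omega
        rw [ncard_inducing_succ_node h hd hn, size_node]
        push_cast
        have h1 : ∑ i, ((Inducing d (h + 1) (f i)).ncard : ℝ) ≤
            copiesCoeff d (h + 1) * ∑ i, ((f i).size : ℝ) ^ d ^ (h + 1) := by
          rw [Finset.mul_sum]
          exact Finset.sum_le_sum fun i _ => ih i (hT.2 i)
        split_ifs with hnd
        · subst hnd
          have h2 : ∏ i, ((Inducing (n + 1) h (f i)).ncard : ℝ) ≤
              copiesCoeff (n + 1) h ^ (n + 1) * ∏ i, ((f i).size : ℝ) ^ (n + 1) ^ h := by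
            calc ∏ i, ((Inducing (n + 1) h (f i)).ncard : ℝ)
                ≤ ∏ i, (copiesCoeff (n + 1) h * ((f i).size : ℝ) ^ (n + 1) ^ h) :=
                  Finset.prod_le_prod (fun i _ => Nat.cast_nonneg _) fun i _ => ihh (hT.2 i)
              _ = _ := by simp [Finset.prod_mul_distrib]
          -- The coefficients are defined so that the product term carries exactly the constant of
          -- `sum_pow_add_le_pow_sum`.
          have h3 : copiesCoeff (n + 1) h ^ (n + 1) = copiesCoeff (n + 1) (h + 1) *
              (((n + 1 : ℕ) : ℝ) ^ (n + 1) ^ (h + 1) - (n + 1 : ℕ)) := by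
            rw [copiesCoeff, div_mul_cancel₀ _ hpos.ne']
          have h4 := sum_pow_add_le_pow_sum (d := n + 1) (b := (n + 1) ^ h) (by omega)
            (by positivity) (fun i => ((f i).size : ℝ)) fun i => Nat.cast_nonneg _
          rw [← pow_succ'] at h4
          have h5 := mul_le_mul_of_nonneg_left h4 hc
          rw [h3] at h2
          push_cast at h2 h5 ⊢
          linarith
        -- With fewer than d branches there is no product term, and superadditivity of the power
        -- suffices.
        · have h2 := sum_pow_le_pow_sum Finset.univ (fun i => ((f i).size : ℝ))
            (fun i _ => Nat.cast_nonneg _) (m := d ^ (h + 1)) (by positivity)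
          have h3 := mul_le_mul_of_nonneg_left h2 hc
          linarith

/-! ### Complete trees attain the bound asymptotically. -/

/-- The complete `d`-ary tree of height `k`. -/
def complete (d : ℕ) : ℕ → RTree
  | 0 => node 0 Fin.elim0
  | k + 1 => node d fun _ => complete d k

theorem full_complete (d k : ℕ) : Full d k (complete d k) := by
  induction k with
  | zero => rfl
  | succ k ih => exact ⟨rfl, fun _ => ih⟩

theorem size_complete {d : ℕ} (hd : 2 ≤ d) (k : ℕ) : (complete d k).size = d ^ k :=
  (full_complete d k).size (by omega)

theorem ncard_inducing_complete_succ {d : ℕ} (hd : 2 ≤ d) (h k : ℕ) :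
    (Inducing d (h + 1) (complete d (k + 1))).ncard =
      d * (Inducing d (h + 1) (complete d k)).ncard + (Inducing d h (complete d k)).ncard ^ d := by
  obtain ⟨n, rfl⟩ : ∃ n, d = n + 1 := ⟨d - 1, by omega⟩
  rw [complete, ncard_inducing_succ_node h hd le_rfl]
  simp

theorem tendsto_ncard_inducing_complete {d : ℕ} (hd : 2 ≤ d) (h : ℕ) :
    Tendsto (fun k => ((Inducing d h (complete d k)).ncard : ℝ) / ((d : ℝ) ^ k) ^ d ^ h) atTop
      (𝓝 (copiesCoeff d h)) := by
  have hd0 : (0 : ℝ) < d := by exact_mod_cast (by omega : 0 < d)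
  induction h with
  | zero =>
    refine tendsto_const_nhds.congr fun k => ?_
    rw [ncard_inducing_zero hd, size_complete hd, pow_zero, pow_one, copiesCoeff]
    push_cast
    rw [div_self (by positivity)]
  | succ h ih =>
    have hpos := pow_sub_self_pos hd h
    have hm : (0 : ℝ) < (d : ℝ) ^ d ^ (h + 1) := by positivity
    have key := tendsto_of_affine_recursion
      (r := fun k => ((Inducing d (h + 1) (complete d k)).ncard : ℝ) /
        ((d : ℝ) ^ k) ^ d ^ (h + 1))
      (ρ := (d : ℝ) / (d : ℝ) ^ d ^ (h + 1)) (by positivity)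
      ((div_lt_one hm).2 (by linarith)) ((ih.pow d).div_const ((d : ℝ) ^ d ^ (h + 1))) ?_
    · convert key using 2
      rw [copiesCoeff]
      field_simp
    · intro k
      simp only [ncard_inducing_complete_succ hd]
      push_cast
      rw [div_pow, ← pow_mul ((d : ℝ) ^ k), ← pow_succ, pow_succ (d : ℝ) k, mul_pow]
      field_simp

/-! ### From counts to the inducibility. -/

theorem maxDensity_nonneg (d : ℕ) (D : RTree) (n : ℕ) : 0 ≤ maxDensity d D n :=
  Real.sSup_nonneg fun _ ⟨T, _, _, hx⟩ => hx ▸ (density_mem_Icc D T).1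

theorem maxDensity_le_one (d : ℕ) (D : RTree) (n : ℕ) : maxDensity d D n ≤ 1 :=
  Real.sSup_le (fun _ ⟨T, _, _, hx⟩ => hx ▸ (density_mem_Icc D T).2) zero_le_one

theorem density_le_maxDensity {d : ℕ} (D : RTree) {T : RTree} (hT : T.IsDary d) :
    density D T ≤ maxDensity d D T.size :=
  le_csSup ⟨1, fun _ ⟨T, _, _, hx⟩ => hx ▸ (density_mem_Icc D T).2⟩ ⟨T, hT, rfl, rfl⟩

/-- For n < d^h the binomial coefficient vanishes and both quotients are 0 by convention; for n = 0
the supremum is over the empty set, hence 0. -/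
theorem Full.maxDensity_le {d : ℕ} (hd : 2 ≤ d) {h : ℕ} {C : RTree} (hC : Full d h C) (n : ℕ) :
    maxDensity d C n ≤ copiesCoeff d h * ((n : ℝ) ^ d ^ h / (n.choose (d ^ h) : ℝ)) := by
  have hc := copiesCoeff_nonneg hd h
  refine Real.sSup_le ?_ (by positivity)
  rintro _ ⟨T, hT, rfl, rfl⟩
  rw [density, hC.copies_eq hd, hC.size (by omega), ← mul_div_assoc]
  exact div_le_div_of_nonneg_right (ncard_inducing_le hd h hT) (Nat.cast_nonneg _)

theorem Full.inducibility_eq {d : ℕ} (hd : 2 ≤ d) {h : ℕ} {C : RTree} (hC : Full d h C) :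
    inducibility d C = copiesCoeff d h * ((d ^ h).factorial : ℝ) := by
  have hbdd : ∀ l : Filter ℕ, l.IsBoundedUnder (· ≤ ·) fun n => maxDensity d C n := fun l =>
    isBoundedUnder_of ⟨1, fun n => maxDensity_le_one d C n⟩
  have hcobdd : ∀ (l : Filter ℕ) [l.NeBot], l.IsCoboundedUnder (· ≤ ·) fun n => maxDensity d C n :=
    fun l _ => (isBoundedUnder_of ⟨0, fun n => maxDensity_nonneg d C n⟩ :
      l.IsBoundedUnder (· ≥ ·) fun n => maxDensity d C n).isCoboundedUnder_le
  apply le_antisymm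
  · have hlim := (tendsto_pow_div_choose (d ^ h)).const_mul (copiesCoeff d h)
    rw [← hlim.limsup_eq]
    exact limsup_le_limsup (Eventually.of_forall fun n => hC.maxDensity_le hd n) (hcobdd _)
      hlim.isBoundedUnder_le
  · have hsize : Tendsto (fun k => d ^ k) atTop atTop :=
      tendsto_pow_atTop_atTop_of_one_lt (by omega)
    have hlim := (tendsto_ncard_inducing_complete hd h).mul
      ((tendsto_pow_div_choose (d ^ h)).comp hsize)
    rw [← hlim.limsup_eq]
    calc _ ≤ limsup (fun k => maxDensity d C (d ^ k)) atTop := by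
          refine limsup_le_limsup (Eventually.of_forall fun k => ?_) hlim.isCoboundedUnder_le
            (isBoundedUnder_of ⟨1, fun k => maxDensity_le_one d C (d ^ k)⟩)
          have h1 := density_le_maxDensity C ((full_complete d k).isDary hd)
          rw [size_complete hd, density, hC.copies_eq hd, hC.size (by omega),
            size_complete hd] at h1
          refine le_of_eq_of_le ?_ h1
          have : (d : ℝ) ≠ 0 := by exact_mod_cast (by omega : d ≠ 0)
          simp only [Function.comp_apply, Nat.cast_pow]
          field_simp
      -- The limsup along the sizes d^k is one along a filter finer than `atTop`, hence at most the
      -- full limsup.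
      _ = limsup (fun n => maxDensity d C n) (map (fun k => d ^ k) atTop) := rfl
      _ ≤ inducibility d C := limsup_le_limsup_of_le hsize (hcobdd _) (hbdd _)

end RTree

theorem mainTheorem10 (d h : ℕ) (hd : 2 ≤ d) (C : RTree) (hC : C.IsComplete d h) :
    RTree.inducibility d C =
      ((d ^ h).factorial : ℝ) *
        ∏ i ∈ Finset.range h, ((d : ℝ) ^ (d ^ (h - i)) - (d : ℝ)) ^ (-((d : ℤ) ^ i)) := by
  rw [hC.full.inducibility_eq hd, RTree.copiesCoeff_eq_prod, mul_comm]
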